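/- **Theorem 5.2 (Robinson stability and Lipschitz-like property of parametric variational systems).** *Notation.* For $\Omega\subset\mathbb R^d$ and $\bar z\in\Omega$: the contingent cone $T_\Omega(\bar z)$ is the set of all $u$ for which there are $t_k\downarrow 0$ and $u_k\to u$ with $\bar z+t_ku_k\in\Omega$ for all $k$; $\widehat N_\Omega(\bar z)=\{v\mid\langle v,u\rangle\le 0\ \forall u\in T_\Omega(\bar z)\}$; the limiting normal cone $N_\Omega(\bar z)$ is the set of all limits of sequences $v_k\in\widehat N_\Omega(z_k)$ with $z_k\in\Omega$, $z_k\to\bar z$; and for a direction $w$, $N_\Omega(\bar z;w)$ is the set of all limits of sequences $v_k\in\widehat N_\Omega(\bar z+t_kw_k)$ with $t_k\downarrow 0$, $w_k\to w$, $\bar z+t_kw_k\in\Omega$. The graph of a set-valued map $S$ is $\operatorname{gph}S=\{(a,b)\mid b\in S(a)\}$; in particular, $\operatorname{gph}N_{\mathbb R^l_-}=\{(s,y)\mid s\in\mathbb R^l_-,\ y\in N_{\mathbb R^l_-}(s)\}$. A star denotes the transpose of a matrix, $\mathbb B$ the closed Euclidean unit ball, and $\operatorname{dist}(\cdot\,;\emptyset)=+\infty$.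 *Setting.* Let $F:\mathbb R^m\times\mathbb R^n\to\mathbb R^n$ be continuously differentiable, let $\varphi:\mathbb R^m\times\mathbb R^n\to\mathbb R^l$ be of class $C^2$, let $P\subset\mathbb R^m$, and put $$G(p,x,y):=F(p,x)+\nabla_x\varphi(p,x)^*y,\qquad g(p,x,y):=\big(G(p,x,y),(\varphi(p,x),y)\big),\qquad C:=\{0_{\mathbb R^n}\}\times\operatorname{gph}N_{\mathbb R^l_-}.$$ For $p\in P$ let $\Gamma(p):=\{(x,y)\in\mathbb R^n\times\mathbb R^l\mid g(p,x,y)\in C\}$, that is, the set of solutions $(x,y)$ of the KKT system $F(p,x)+\nabla_x\varphi(p,x)^*y=0$, $(\varphi(p,x),y)\in\operatorname{gph}N_{\mathbb R^l_-}$. Let $\bar p\in P$ and $(\bar x,\bar y)\in\Gamma(\bar p)$. *Hypotheses.* Consider, for $w\in T_P(\bar p)$ and $(u,v)\in\mathbb R^n\times\mathbb R^l$, the linearized system $$\nabla_pG(\bar p,\bar x,\bar y)w+\nabla_xG(\bar p,\bar x,\bar y)u+\nabla_x\varphi(\bar p,\bar x)^*v=0,\qquad \big(\nabla\varphi(\bar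 p,\bar x)(w,u),v\big)\in T_{\operatorname{gph}N_{\mathbb R^l_-}}\big(\varphi(\bar p,\bar x),\bar y\big).\tag{1}$$ 1. For every $w\in T_P(\bar p)$ there is a pair $(u,v)\in\mathbb R^n\times\mathbb R^l$ satisfying (1). 2. For every triple $(w,u,v)\ne(0,0,0)$ with $w\in T_P(\bar p)$ satisfying (1) and every $(z,\lambda,d)\in\mathbb R^n\times\mathbb R^l\times\mathbb R^l$, the three conditions $$\nabla_xG(\bar p,\bar x,\bar y)^*z+\nabla_x\varphi(\bar p,\bar x)^*\lambda=0,\qquad \nabla_x\varphi(\bar p,\bar x)z+d=0,$$ $$(\lambda,d)\in N_{\operatorname{gph}N_{\mathbb R^l_-}}\Big(\big(\varphi(\bar p,\bar x),\bar y\big);\big(\nabla\varphi(\bar p,\bar x)(w,u),v\big)\Big)$$ imply $(z,\lambda)=(0,0)$. *Conclusion.* Robinson stability holds at $(\bar p,\bar x,\bar y)$ for the system $g(p,x,y)\in C$: there are $\kappa\ge 0$ and neighborhoods $V$ of $\bar p$ in $P$ and $U$ of $(\bar x,\bar y)$ such that $$\operatorname{dist}\big((x,y);\Gamma(p)\big)\le\kappa\,\operatorname{dist}\big(g(p,x,y);C\big)\quad\text{for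 all }(p,(x,y))\in V\times U.$$ Moreover, $\Gamma:P\rightrightarrows\mathbb R^n\times\mathbb R^l$ is Lipschitz-like (has the Aubin property) around $(\bar p,\bar x,\bar y)$: there are $\ell\ge 0$ and neighborhoods $V$ of $\bar p$ in $P$ and $U$ of $(\bar x,\bar y)$ such that $$\Gamma(p)\cap U\subset\Gamma(p')+\ell\,\|p-p'\|\,\mathbb B\quad\text{for all }p,p'\in V.$$ -/

import Mathlib

open Filter Topology
open scoped NNReal ENNReal

/-- The (Bouligand-Severi) contingent cone to `Ω` at `z`: all `u` for which there are `t_k ↓ 0` and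
`u_k → u` with `z + t_k u_k ∈ Ω` for all `k`. -/
def contingentCone {E : Type*} [NormedAddCommGroup E] [NormedSpace ℝ E] (Ω : Set E) (z : E) :
    Set E :=
  {u | ∃ (t : ℕ → ℝ) (s : ℕ → E), (∀ k, 0 < t k) ∧ Tendsto t atTop (𝓝 0) ∧
    Tendsto s atTop (𝓝 u) ∧ ∀ k, z + t k • s k ∈ Ω}

/-- The (Fréchet) regular normal cone: the polar of the contingent cone. It is only used below at
points of `Ω`. -/
def regularNormalCone {E : Type*} [NormedAddCommGroup E] [InnerProductSpace ℝ E]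
    (Ω : Set E) (z : E) : Set E :=
  {v | ∀ u ∈ contingentCone Ω z, inner ℝ v u ≤ 0}

/-- The (Mordukhovich) limiting normal cone. -/
def limitingNormalCone {E : Type*} [NormedAddCommGroup E] [InnerProductSpace ℝ E]
    (Ω : Set E) (z : E) : Set E :=
  {v | ∃ (a : ℕ → E) (b : ℕ → E), Tendsto a atTop (𝓝 z) ∧ Tendsto b atTop (𝓝 v) ∧
    ∀ k, a k ∈ Ω ∧ b k ∈ regularNormalCone Ω (a k)}

/-- The limiting normal cone to `Ω` at `z` in direction `w`. -/
def directionalNormalCone {E : Type*} [NormedAddCommGroup E] [InnerProductSpace ℝ E]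
    (Ω : Set E) (z w : E) : Set E :=
  {v | ∃ (t : ℕ → ℝ) (s : ℕ → E) (b : ℕ → E), (∀ k, 0 < t k) ∧ Tendsto t atTop (𝓝 0) ∧
    Tendsto s atTop (𝓝 w) ∧ Tendsto b atTop (𝓝 v) ∧
    ∀ k, z + t k • s k ∈ Ω ∧ b k ∈ regularNormalCone Ω (z + t k • s k)}

/-- The solution map `Γ(p) = {x | g(p, x) ∈ C}` of the parametric constraint system
`g(p, x) ∈ C`. -/
def solutionMap {Par X Z : Type*} (g : Par → X → Z) (C : Set Z) (p : Par) : Set X :=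
  {x | g p x ∈ C}

/-- Robinson stability of `g(p, x) ∈ C` at `(pbar, xbar)`:
`dist(x; Γ(p)) ≤ κ dist(g(p, x); C)` for all `(p, x)` near `(pbar, xbar)`. The distances are
extended-valued, so that the distance to the empty set is `+∞`. -/
def RobinsonStable {Par X Z : Type*} [TopologicalSpace Par] [PseudoMetricSpace X]
    [PseudoMetricSpace Z] (g : Par → X → Z) (C : Set Z) (pbar : Par) (xbar : X) : Prop :=
  ∃ κ : ℝ≥0, ∃ V ∈ 𝓝 pbar, ∃ U ∈ 𝓝 xbar, ∀ p ∈ V, ∀ x ∈ U,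
    Metric.infEDist x (solutionMap g C p) ≤ (κ : ℝ≥0∞) * Metric.infEDist (g p x) C

/-- The Lipschitz-like (Aubin) property of a set-valued map `Γ` around `(pbar, xbar)`:
`Γ(p) ∩ U ⊆ Γ(p') + ℓ ρ(p, p') 𝔹` for all `p, p' ∈ V`, with `𝔹` the closed unit ball. -/
def LipschitzLike {Par X : Type*} [PseudoMetricSpace Par] [NormedAddCommGroup X]
    (Γ : Par → Set X) (pbar : Par) (xbar : X) : Prop :=
  ∃ ℓ : ℝ, 0 ≤ ℓ ∧ ∃ V ∈ 𝓝 pbar, ∃ U ∈ 𝓝 xbar, ∀ p ∈ V, ∀ p' ∈ V,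
    ∀ x ∈ Γ p ∩ U, ∃ x' ∈ Γ p', ‖x - x'‖ ≤ ℓ * dist p p'

/-- The Euclidean space `ℝⁿ`. -/
abbrev Vec (n : ℕ) : Type := EuclideanSpace ℝ (Fin n)

/-- The nonpositive orthant `ℝ₋ˡ`. -/
def nonposOrthant (l : ℕ) : Set (Vec l) :=
  {s | ∀ i, s i ≤ 0}

/-- The graph of the normal cone mapping of `ℝ₋ˡ`, in the Euclidean space `ℝˡ × ℝˡ`. -/
def graphNormalOrthant (l : ℕ) : Set (WithLp 2 (Vec l × Vec l)) :=
  {a | a.fst ∈ nonposOrthant l ∧ a.snd ∈ limitingNormalCone (nonposOrthant l) a.fst}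

/-- The adjoint (transpose) `∇ₓφ(p, x)*` of the partial derivative of `φ` in `x`. -/
noncomputable def partialGradAdjoint {m n l : ℕ} (φ : Vec m → Vec n → Vec l) (p : Vec m)
    (x : Vec n) : Vec l →L[ℝ] Vec n :=
  ContinuousLinearMap.adjoint (fderiv ℝ (φ p) x)

/-- The Lagrangian `G(p, x, y) = F(p, x) + ∇ₓφ(p, x)* y`. -/
noncomputable def lagrangian {m n l : ℕ} (F : Vec m → Vec n → Vec n)
    (φ : Vec m → Vec n → Vec l) (p : Vec m) (x : Vec n) (y : Vec l) : Vec n :=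
  F p x + partialGradAdjoint φ p x y

/-- The map `g(p, x, y) = (G(p, x, y), (φ(p, x), y))` of the KKT system, for parameters in `P`. -/
noncomputable def kktMap {m n l : ℕ} (P : Set (Vec m)) (F : Vec m → Vec n → Vec n)
    (φ : Vec m → Vec n → Vec l) (p : P) (ξ : WithLp 2 (Vec n × Vec l)) :
    WithLp 2 (Vec n × WithLp 2 (Vec l × Vec l)) :=
  WithLp.toLp 2 (lagrangian F φ p ξ.fst ξ.snd, WithLp.toLp 2 (φ p ξ.fst, ξ.snd))

/-- The set `C = {0} × gph N_{ℝ₋ˡ}` of the KKT system. -/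
def kktSet (n l : ℕ) : Set (WithLp 2 (Vec n × WithLp 2 (Vec l × Vec l))) :=
  {c | c.fst = 0 ∧ c.snd ∈ graphNormalOrthant l}

/-- `(w, u, v)` solves the KKT system linearized at `(p, x, y)`:
`∇ₚG w + ∇ₓG u + ∇ₓφ* v = 0` and `(∇φ (w, u), v)` is tangent to `gph N_{ℝ₋ˡ}` at `(φ(p, x), y)`. -/
def LinearizedKKT {m n l : ℕ} (F : Vec m → Vec n → Vec n) (φ : Vec m → Vec n → Vec l)
    (p : Vec m) (x : Vec n) (y : Vec l) (w : Vec m) (u : Vec n) (v : Vec l) : Prop :=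
  fderiv ℝ (fun p' => lagrangian F φ p' x y) p w
      + fderiv ℝ (fun x' => lagrangian F φ p x' y) x u
      + partialGradAdjoint φ p x v = 0 ∧
  WithLp.toLp 2 (fderiv ℝ (Function.uncurry φ) (p, x) (w, u), v) ∈
    contingentCone (graphNormalOrthant l) (WithLp.toLp 2 (φ p x, y))

/-- The multipliers `(z, lam, d)` satisfy the adjoint system at `(p, x, y)` in the direction
`(w, u, v)`: `∇ₓG* z + ∇ₓφ* lam = 0`, `∇ₓφ z + d = 0`, and `(lam, d)` is a normal to `gph N_{ℝ₋ˡ}`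
at `(φ(p, x), y)` in direction `(∇φ (w, u), v)`. -/
def AdjointKKT {m n l : ℕ} (F : Vec m → Vec n → Vec n) (φ : Vec m → Vec n → Vec l)
    (p : Vec m) (x : Vec n) (y : Vec l) (w : Vec m) (u : Vec n) (v : Vec l)
    (z : Vec n) (lam d : Vec l) : Prop :=
  ContinuousLinearMap.adjoint (fderiv ℝ (fun x' => lagrangian F φ p x' y) x) z
      + partialGradAdjoint φ p x lam = 0 ∧
  fderiv ℝ (φ p) x z + d = 0 ∧
  WithLp.toLp 2 (lam, d) ∈ directionalNormalCone (graphNormalOrthant l)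
    (WithLp.toLp 2 (φ p x, y))
    (WithLp.toLp 2 (fderiv ℝ (Function.uncurry φ) (p, x) (w, u), v))

/-! The proof is by contradiction, for a general system f(p, x) ∈ C with f of class C¹ and C closed
in finite dimensions. Suppose a point has a residual below ρr while no solution with the same
parameter lies within r. Minimizing the residual plus ρ times the distance to the point yields a
nearby point whose partial derivative is almost annihilated by a unit normal to C
(`exists_almost_critical_normal`).

Take such points at scale t along a nonzero direction (w, u), with r = σt and ρ, σ → 0. The
corrections are o(t), so the base points of the normals approach f(p, x) in the direction ∇f(w, u).
A limit of the unit normals is then a nonzero directional normal annihilating the range of the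
partial derivative, which the multiplier condition forbids
(`DirectionalMultiplierCondition.not_forall_far`).

This contradiction is used twice. Solvability of the linearized system, with tangents realized by
segments in C, gives residuals o(t) and hence solutions within a multiple of ‖p' - p‖ of x
(`exists_solution_norm_sub_le`). That bound in turn forces σ → 0 along any sequence violating
Robinson stability. The Aubin property follows, since f is Lipschitz in p near the reference point.

For the KKT system, `kktSet` is a finite union of polyhedra described by complementarity, so its
tangents are segments. The remaining work identifies derivatives and normals with the linearized and
adjoint systems. -/

/-! ### Variational preliminaries: normals and the penalized residual. -/

/-- Difference quotients along converging directions converge to the derivative. -/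
theorem HasFDerivAt.tendsto_quotient {E F : Type*} [NormedAddCommGroup E] [NormedSpace ℝ E]
    [NormedAddCommGroup F] [NormedSpace ℝ F] {f : E → F} {f' : E →L[ℝ] F} {a : E}
    (hf : HasFDerivAt f f' a) {t : ℕ → ℝ} {d : ℕ → E} {d₀ : E} (ht : ∀ k, 0 < t k)
    (ht0 : Tendsto t atTop (𝓝 0)) (hd : Tendsto d atTop (𝓝 d₀)) :
    Tendsto (fun k => (t k)⁻¹ • (f (a + t k • d k) - f a)) atTop (𝓝 (f' d₀)) := by
  have hw : HasFDerivWithinAt f f' Set.univ a := hf.hasFDerivWithinAt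
  have hcd : Tendsto (fun k => (t k)⁻¹ • t k • d k) atTop (𝓝 d₀) := by
    refine hd.congr fun k => ?_
    rw [smul_smul, inv_mul_cancel₀ (ht k).ne', one_smul]
  refine hw.lim ?_ (Eventually.of_forall fun k => Set.mem_univ _) hcd
  simpa using ht0.smul hd

/-- The regular normal cone is closed under multiplication by nonnegative scalars. -/
theorem smul_mem_regularNormalCone {E : Type*} [NormedAddCommGroup E] [InnerProductSpace ℝ E]
    {Ω : Set E} {z v : E} (hv : v ∈ regularNormalCone Ω z) {r : ℝ} (hr : 0 ≤ r) :
    r • v ∈ regularNormalCone Ω z := by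
  intro u hu
  rw [real_inner_smul_left]
  exact mul_nonpos_of_nonneg_of_nonpos hr (hv u hu)

/-- Proximal normals are regular normals. -/
theorem sub_mem_regularNormalCone_of_forall_norm_le {E : Type*} [NormedAddCommGroup E]
    [InnerProductSpace ℝ E] {Ω : Set E} {y c : E} (h : ∀ c' ∈ Ω, ‖y - c‖ ≤ ‖y - c'‖) :
    y - c ∈ regularNormalCone Ω c := by
  rintro u ⟨t, s, ht, ht0, hs, hmem⟩
  have hlim : Tendsto (fun k => t k * ‖s k‖ ^ 2) atTop (𝓝 (0 * ‖u‖ ^ 2)) :=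
    ht0.mul (hs.norm.pow 2)
  have hlim' : Tendsto (fun k => 2 * inner ℝ (y - c) (s k)) atTop (𝓝 (2 * inner ℝ (y - c) u)) :=
    (tendsto_const_nhds.inner hs).const_mul 2
  have hle : 2 * inner ℝ (y - c) u ≤ 0 * ‖u‖ ^ 2 := by
    refine le_of_tendsto_of_tendsto' hlim' hlim fun k => ?_
    have h1 := h _ (hmem k)
    -- Expanding the square and dividing by `t k` leaves a bound of order `t k` on the inner
    -- product.
    have h2 : ‖y - c‖ ^ 2 ≤ ‖(y - c) - t k • s k‖ ^ 2 := by
      rw [sub_sub]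
      gcongr
    rw [norm_sub_sq_real (y - c), real_inner_smul_right, norm_smul, mul_pow, Real.norm_eq_abs,
      sq_abs] at h2
    have h3 : 0 ≤ t k * (t k * ‖s k‖ ^ 2 - 2 * inner ℝ (y - c) (s k)) := by linarith
    have h4 := nonneg_of_mul_nonneg_right h3 (ht k)
    linarith
  linarith

/-- A Fermat rule for `x ↦ ‖h x - c‖ + ρ ‖x - x₀‖`. -/
theorem neg_mul_norm_le_inner_fderiv {X Z : Type*} [NormedAddCommGroup X] [NormedSpace ℝ X]
    [NormedAddCommGroup Z] [InnerProductSpace ℝ Z] {h : X → Z} {h' : X →L[ℝ] Z} {x : X} {c : Z}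
    {ρ : ℝ} (hd : HasFDerivAt h h' x)
    (hmin : ∀ x', ‖h x - c‖ ≤ ‖h x' - c‖ + ρ * ‖x' - x‖) (v : X) :
    -(‖h x - c‖ * (ρ * ‖v‖)) ≤ inner ℝ (h x - c) (h' v) := by
  set t : ℕ → ℝ := fun k => 1 / ((k : ℝ) + 1)
  have ht : ∀ k, 0 < t k := fun k => by positivity
  have ht0 : Tendsto t atTop (𝓝 0) := tendsto_one_div_add_atTop_nhds_zero_nat
  have hq := hd.tendsto_quotient ht ht0 (tendsto_const_nhds (x := v))
  set q : ℕ → Z := fun k => (t k)⁻¹ • (h (x + t k • v) - h x) with hqdef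
  have hlim : Tendsto (fun k => 2 * inner ℝ (h x - c) (q k) + t k * ‖q k‖ ^ 2) atTop
      (𝓝 (2 * inner ℝ (h x - c) (h' v) + 0 * ‖h' v‖ ^ 2)) :=
    ((tendsto_const_nhds.inner hq).const_mul 2).add (ht0.mul (hq.norm.pow 2))
  have hle : 2 * -(‖h x - c‖ * (ρ * ‖v‖)) ≤ 2 * inner ℝ (h x - c) (h' v) + 0 * ‖h' v‖ ^ 2 := by
    refine ge_of_tendsto' hlim fun k => ?_
    have htk := ht k
    have h1 := hmin (x + t k • v)
    have h2 : h (x + t k • v) - c = (h x - c) + t k • q k := by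
      rw [hqdef]
      simp only [smul_smul, mul_inv_cancel₀ htk.ne', one_smul]
      abel
    rw [h2, add_sub_cancel_left, norm_smul, Real.norm_eq_abs, abs_of_pos htk] at h1
    have h3 := norm_add_sq_real (h x - c) (t k • q k)
    rw [real_inner_smul_right, norm_smul, mul_pow, Real.norm_eq_abs, sq_abs] at h3
    have h4 : ‖h x - c‖ ^ 2 - 2 * ‖h x - c‖ * (ρ * (t k * ‖v‖)) ≤ ‖(h x - c) + t k • q k‖ ^ 2 := by
      have ha := norm_nonneg (h x - c)
      have hb := norm_nonneg ((h x - c) + t k • q k)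
      generalize ‖(h x - c) + t k • q k‖ = B at *
      generalize ‖h x - c‖ = A at *
      generalize ρ * (t k * ‖v‖) = e at *
      -- `A - e ≤ B` may be squared only if `e ≤ A`; otherwise the left side is at most `-A ^ 2`.
      rcases le_total e A with hc | hc
      · have h5 : (A - e) ^ 2 ≤ B ^ 2 := pow_le_pow_left₀ (by linarith) (by linarith) 2
        linarith [sq_nonneg e]
      · have h5 : A * A ≤ A * e := mul_le_mul_of_nonneg_left hc ha
        linarith [sq_nonneg B, mul_self_nonneg A]
    have h5 : 0 ≤ t k * (2 * inner ℝ (h x - c) (q k) + t k * ‖q k‖ ^ 2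
        - 2 * -(‖h x - c‖ * (ρ * ‖v‖))) := by
      rw [h3] at h4
      linarith
    have h6 := nonneg_of_mul_nonneg_right h5 htk
    linarith
  linarith

/-- If `h x` is almost in `C` while the solutions of `h x' ∈ C` are far from `x`, then near `x`
there is a point with an almost critical unit normal. -/
theorem exists_almost_critical_normal {X Z : Type*} [NormedAddCommGroup X] [NormedSpace ℝ X]
    [FiniteDimensional ℝ X] [NormedAddCommGroup Z] [InnerProductSpace ℝ Z] [FiniteDimensional ℝ Z]
    {h : X → Z} (hdiff : Differentiable ℝ h) {C : Set Z} (hC : IsClosed C) (hne : C.Nonempty)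
    {x : X} {ρ r : ℝ} (hρ : 0 < ρ) (hclose : Metric.infDist (h x) C < ρ * r)
    (hfar : ∀ x', h x' ∈ C → r < ‖x - x'‖) :
    ∃ x' c lam, ‖x' - x‖ < r ∧ c ∈ C ∧ ‖h x' - c‖ < ρ * r ∧ ‖lam‖ = 1 ∧
      lam ∈ regularNormalCone C c ∧ ∀ v, -(ρ * ‖v‖) ≤ inner ℝ lam (fderiv ℝ h x' v) := by
  have : ProperSpace X := FiniteDimensional.proper ℝ X
  have : ProperSpace Z := FiniteDimensional.proper ℝ Z
  -- Outside the ball of radius `r` the penalty alone exceeds `ψ x`, so a minimizer over this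
  -- compact ball is a global one.
  set ψ : X → ℝ := fun ξ => Metric.infDist (h ξ) C + ρ * ‖ξ - x‖ with hψ
  have hψc : Continuous ψ :=
    ((Metric.continuous_infDist_pt C).comp hdiff.continuous).add (by fun_prop)
  have hr : 0 < r := by
    have := Metric.infDist_nonneg.trans_lt hclose
    exact pos_of_mul_pos_right this hρ.le
  have hψx : ψ x = Metric.infDist (h x) C := by simp [hψ]
  obtain ⟨x', hx', hmin⟩ := (isCompact_closedBall x r).exists_isMinOn
    ⟨x, Metric.mem_closedBall_self hr.le⟩ hψc.continuousOn
  have hminx : ψ x' ≤ ψ x := hmin (Metric.mem_closedBall_self hr.le)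
  have hglob : ∀ ξ, ψ x' ≤ ψ ξ := by
    intro ξ
    by_cases hξ : ξ ∈ Metric.closedBall x r
    · exact hmin hξ
    · rw [Metric.mem_closedBall, dist_eq_norm, not_le] at hξ
      have h1 : ρ * r ≤ ρ * ‖ξ - x‖ := by gcongr
      have h2 : 0 ≤ Metric.infDist (h ξ) C := Metric.infDist_nonneg
      have h3 : ψ ξ = Metric.infDist (h ξ) C + ρ * ‖ξ - x‖ := rfl
      linarith
  have hval : Metric.infDist (h x') C + ρ * ‖x' - x‖ < ρ * r := by
    have h3 : ψ x' = Metric.infDist (h x') C + ρ * ‖x' - x‖ := rfl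
    linarith
  have hnear : ‖x' - x‖ < r := by
    have h2 : 0 ≤ Metric.infDist (h x') C := Metric.infDist_nonneg
    exact lt_of_mul_lt_mul_left (by linarith) hρ.le
  obtain ⟨c, hcC, hc⟩ := hC.exists_infDist_eq_dist hne (h x')
  rw [dist_eq_norm] at hc
  -- `x'` is too close to `x` to be a solution, so the residual there can be normalized.
  have hpos : 0 < ‖h x' - c‖ := by
    rw [norm_pos_iff]
    intro h0
    have := hfar x' (by rwa [sub_eq_zero.1 h0])
    rw [norm_sub_rev] at this
    linarith
  refine ⟨x', c, ‖h x' - c‖⁻¹ • (h x' - c), hnear, hcC, ?_, ?_, ?_, fun v => ?_⟩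
  · have : 0 ≤ ρ * ‖x' - x‖ := by positivity
    linarith
  · rw [norm_smul, norm_inv, norm_norm, inv_mul_cancel₀ hpos.ne']
  · refine smul_mem_regularNormalCone (sub_mem_regularNormalCone_of_forall_norm_le ?_)
      (inv_nonneg.2 (norm_nonneg _))
    intro c' hc'
    rw [← hc, ← dist_eq_norm]
    exact Metric.infDist_le_dist_of_mem hc'
  -- Replacing the distance to `C` by the distance to `c` keeps `x'` minimal: the two agree at `x'`,
  -- and the latter is never smaller.
  · have key := neg_mul_norm_le_inner_fderiv (c := c) (ρ := ρ) (hdiff x').hasFDerivAt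
      (fun ξ => ?_) v
    · rw [real_inner_smul_left, inv_mul_eq_div, le_div_iff₀ hpos]
      linarith
    · have h1 : Metric.infDist (h x') C + ρ * ‖x' - x‖ ≤ Metric.infDist (h ξ) C + ρ * ‖ξ - x‖ :=
        hglob ξ
      have h2 : Metric.infDist (h ξ) C ≤ ‖h ξ - c‖ := by
        rw [← dist_eq_norm]
        exact Metric.infDist_le_dist_of_mem hcC
      have h3 : ‖ξ - x‖ ≤ ‖ξ - x'‖ + ‖x' - x‖ := norm_sub_le_norm_sub_add_norm_sub _ _ _
      have h4 : ρ * ‖ξ - x‖ ≤ ρ * (‖ξ - x'‖ + ‖x' - x‖) := by gcongr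
      linarith

/-! ### Robinson stability of an abstract constraint system. -/

/-- Every tangent to `C` at `c` is the direction of a short segment in `C` issuing from `c`. -/
def HasExactTangents {Z : Type*} [NormedAddCommGroup Z] [NormedSpace ℝ Z] (C : Set Z) (c : Z) :
    Prop :=
  ∀ v ∈ contingentCone C c, ∀ᶠ t : ℝ in 𝓝[>] 0, c + t • v ∈ C

/-- The directional multiplier condition: only the zero multiplier is orthogonal to the range of
the partial derivative of `f` and normal to `C` in a nonzero critical direction. -/
def DirectionalMultiplierCondition {Par X Z : Type*} [NormedAddCommGroup Par] [NormedSpace ℝ Par]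
    [NormedAddCommGroup X] [NormedSpace ℝ X] [NormedAddCommGroup Z] [InnerProductSpace ℝ Z]
    (P : Set Par) (f : Par × X → Z) (C : Set Z) (p : Par) (x : X) : Prop :=
  ∀ w ∈ contingentCone P p, ∀ u : X, (w, u) ≠ 0 →
    fderiv ℝ f (p, x) (w, u) ∈ contingentCone C (f (p, x)) →
    ∀ lam ∈ directionalNormalCone C (f (p, x)) (fderiv ℝ f (p, x) (w, u)),
      (∀ v : X, inner ℝ lam (fderiv ℝ f (p, x) (0, v)) = 0) → lam = 0

section Abstract

variable {Par X Z : Type*} [NormedAddCommGroup Par] [NormedSpace ℝ Par]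
  [NormedAddCommGroup X] [NormedSpace ℝ X] [FiniteDimensional ℝ X]
  [NormedAddCommGroup Z] [InnerProductSpace ℝ Z] [FiniteDimensional ℝ Z]
  {P : Set Par} {f : Par × X → Z} {C : Set Z} {p : Par} {x : X}

/-- Under the directional multiplier condition there is no sequence of points with almost vanishing
residual, relative to the distance to the solution set, along a nonzero direction. -/
theorem DirectionalMultiplierCondition.not_forall_far
    (hmul : DirectionalMultiplierCondition P f C p x) (hf : ContDiff ℝ 1 f) (hC : IsClosed C)
    (hmem : f (p, x) ∈ C) {t σ ρ : ℕ → ℝ} {w : ℕ → Par} {u : ℕ → X} {w₀ : Par} {u₀ : X}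
    (ht : ∀ k, 0 < t k) (ht0 : Tendsto t atTop (𝓝 0)) (hw : Tendsto w atTop (𝓝 w₀))
    (hu : Tendsto u atTop (𝓝 u₀)) (hσ0 : Tendsto σ atTop (𝓝 0)) (hρ : ∀ k, 0 < ρ k)
    (hρ0 : Tendsto ρ atTop (𝓝 0)) (hne : (w₀, u₀) ≠ 0) (hP : ∀ k, p + t k • w k ∈ P)
    (hclose : ∀ k, Metric.infDist (f (p + t k • w k, x + t k • u k)) C < ρ k * (σ k * t k))
    (hfar : ∀ k, ∀ x', f (p + t k • w k, x') ∈ C → σ k * t k < ‖(x + t k • u k) - x'‖) :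
    False := by
  have hdiff : Differentiable ℝ f := hf.differentiable one_ne_zero
  have hpart : ∀ a ξ, HasFDerivAt (fun ξ' => f (a, ξ'))
      ((fderiv ℝ f (a, ξ)).comp (ContinuousLinearMap.inr ℝ Par X)) ξ := fun a ξ =>
    (hdiff (a, ξ)).hasFDerivAt.comp ξ (hasFDerivAt_prodMk_right a ξ)
  have hkey : ∀ k, ∃ x' c lam, ‖x' - (x + t k • u k)‖ < σ k * t k ∧ c ∈ C ∧
      ‖f (p + t k • w k, x') - c‖ < ρ k * (σ k * t k) ∧ ‖lam‖ = 1 ∧ lam ∈ regularNormalCone C c ∧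
      ∀ v, -(ρ k * ‖v‖) ≤ inner ℝ lam (fderiv ℝ f (p + t k • w k, x') (0, v)) := by
    intro k
    obtain ⟨x', c, lam, h1, h2, h3, h4, h5, h6⟩ := exists_almost_critical_normal
      (h := fun ξ => f (p + t k • w k, ξ)) (fun ξ => (hpart _ ξ).differentiableAt) hC ⟨_, hmem⟩
      (hρ k) (hclose k) (hfar k)
    refine ⟨x', c, lam, h1, h2, h3, h4, h5, fun v => ?_⟩
    have := h6 v
    rwa [(hpart _ x').fderiv] at this
  choose x' c lam hx' hcC hc hlam hreg hcrit using hkey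
  have htinv : ∀ k, t k * (t k)⁻¹ = 1 := fun k => mul_inv_cancel₀ (ht k).ne'
  set u' : ℕ → X := fun k => (t k)⁻¹ • (x' k - x) with hu'
  have hxu' : ∀ k, x' k = x + t k • u' k := fun k => by
    simp [hu', smul_smul, htinv k]
  -- The correction has size below `σ k * t k`, so it does not change the limiting direction.
  have hu'0 : Tendsto u' atTop (𝓝 u₀) := by
    have hd : Tendsto (fun k => u' k - u k) atTop (𝓝 0) := by
      refine squeeze_zero_norm (fun k => ?_) hσ0
      have h1 := hx' k
      rw [hxu' k, add_sub_add_left_eq_sub, ← smul_sub, norm_smul, Real.norm_eq_abs,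
        abs_of_pos (ht k), mul_comm] at h1
      exact (lt_of_mul_lt_mul_right h1 (ht k).le).le
    simpa using hd.add hu
  have hq := (hdiff (p, x)).hasFDerivAt.tendsto_quotient ht ht0 (hw.prodMk_nhds hu'0)
  set q : ℕ → Z := fun k => (t k)⁻¹ • (f ((p, x) + t k • (w k, u' k)) - f (p, x)) with hqdef
  have hfq : ∀ k, f (p + t k • w k, x' k) = f (p, x) + t k • q k := fun k => by
    rw [hqdef]
    simp only [smul_smul, htinv k, one_smul, Prod.smul_mk, Prod.mk_add_mk, ← hxu' k]
    abel
  set s : ℕ → Z := fun k => (t k)⁻¹ • (c k - f (p, x)) with hsdef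
  have hcs : ∀ k, c k = f (p, x) + t k • s k := fun k => by
    simp [hsdef, smul_smul, htinv k]
  have hs : Tendsto s atTop (𝓝 (fderiv ℝ f (p, x) (w₀, u₀))) := by
    have hd : Tendsto (fun k => s k - q k) atTop (𝓝 0) := by
      have hρσ : Tendsto (fun k => ρ k * σ k) atTop (𝓝 0) := by simpa using hρ0.mul hσ0
      refine squeeze_zero_norm (fun k => ?_) hρσ
      have h1 := hc k
      rw [hfq k, hcs k, add_sub_add_left_eq_sub, ← smul_sub, norm_smul, Real.norm_eq_abs,
        abs_of_pos (ht k), ← mul_assoc, mul_comm, norm_sub_rev] at h1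
      exact (lt_of_mul_lt_mul_right h1 (ht k).le).le
    simpa using hd.add hq
  have : ProperSpace Z := FiniteDimensional.proper ℝ Z
  obtain ⟨lam₀, hlam₀, φ, hφ, hlim⟩ := (isCompact_sphere (0 : Z) 1).tendsto_subseq
    (x := lam) (fun k => by simp [hlam k])
  have hφ' := hφ.tendsto_atTop
  have hzero : lam₀ = 0 := by
    refine hmul w₀ ⟨t, w, ht, ht0, hw, hP⟩ u₀ hne
      ⟨t, s, ht, ht0, hs, fun k => hcs k ▸ hcC k⟩ lam₀
      ⟨t ∘ φ, s ∘ φ, lam ∘ φ, fun k => ht _, ht0.comp hφ', hs.comp hφ', hlim, fun k => ?_⟩ ?_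
    · simp only [Function.comp_apply, ← hcs]
      exact ⟨hcC _, hreg _⟩
    · have hx'0 : Tendsto (fun k => (p + t k • w k, x' k)) atTop (𝓝 (p, x)) := by
        have h1 : Tendsto (fun k => p + t k • w k) atTop (𝓝 (p + (0 : ℝ) • w₀)) :=
          tendsto_const_nhds.add (ht0.smul hw)
        have h2 : Tendsto (fun k => x + t k • u' k) atTop (𝓝 (x + (0 : ℝ) • u₀)) :=
          tendsto_const_nhds.add (ht0.smul hu'0)
        simp only [zero_smul, add_zero] at h1 h2
        simp only [hxu']
        exact h1.prodMk_nhds h2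
      have hder : Tendsto (fun k => fderiv ℝ f (p + t k • w k, x' k)) atTop
          (𝓝 (fderiv ℝ f (p, x))) :=
        ((hf.continuous_fderiv one_ne_zero).tendsto (p, x)).comp hx'0
      -- The one-sided bound suffices: applied to `v` and `-v` it gives orthogonality.
      have hge : ∀ v : X, 0 ≤ inner ℝ lam₀ (fderiv ℝ f (p, x) (0, v)) := by
        intro v
        have hl : Tendsto (fun k => -(ρ (φ k) * ‖v‖)) atTop (𝓝 (-(0 * ‖v‖))) :=
          ((hρ0.comp hφ').mul_const _).neg
        have hr : Tendsto (fun k => inner ℝ (lam (φ k))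
            (fderiv ℝ f (p + t (φ k) • w (φ k), x' (φ k)) (0, v))) atTop
            (𝓝 (inner ℝ lam₀ (fderiv ℝ f (p, x) (0, v)))) :=
          hlim.inner
            (((ContinuousLinearMap.apply ℝ Z ((0 : Par), v)).continuous.tendsto _).comp
              (hder.comp hφ'))
        have := le_of_tendsto_of_tendsto' hl hr fun k => hcrit (φ k) v
        simpa using this
      intro v
      refine le_antisymm ?_ (hge v)
      have h1 := hge (-v)
      have h2 : ((0 : Par), -v) = -(0, v) := by simp
      rw [h2, map_neg, inner_neg_right] at h1
      linarith
  simp [hzero] at hlam₀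

/-- The same with the requirements on the sequence only for large indices. -/
theorem DirectionalMultiplierCondition.not_eventually_far
    (hmul : DirectionalMultiplierCondition P f C p x) (hf : ContDiff ℝ 1 f) (hC : IsClosed C)
    (hmem : f (p, x) ∈ C) {t σ ρ : ℕ → ℝ} {w : ℕ → Par} {u : ℕ → X} {w₀ : Par} {u₀ : X}
    (ht : ∀ k, 0 < t k) (ht0 : Tendsto t atTop (𝓝 0)) (hw : Tendsto w atTop (𝓝 w₀))
    (hu : Tendsto u atTop (𝓝 u₀)) (hσ0 : Tendsto σ atTop (𝓝 0)) (hρ : ∀ k, 0 < ρ k)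
    (hρ0 : Tendsto ρ atTop (𝓝 0)) (hne : (w₀, u₀) ≠ 0) (hP : ∀ k, p + t k • w k ∈ P)
    (hclose : ∀ᶠ k in atTop,
      Metric.infDist (f (p + t k • w k, x + t k • u k)) C < ρ k * (σ k * t k))
    (hfar : ∀ᶠ k in atTop,
      ∀ x', f (p + t k • w k, x') ∈ C → σ k * t k < ‖(x + t k • u k) - x'‖) :
    False := by
  obtain ⟨N, hN⟩ := eventually_atTop.1 (hclose.and hfar)
  have hs := tendsto_add_atTop_nat N
  exact hmul.not_forall_far hf hC hmem (t := fun k => t (k + N)) (σ := fun k => σ (k + N))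
    (ρ := fun k => ρ (k + N)) (w := fun k => w (k + N)) (u := fun k => u (k + N))
    (fun k => ht _) (ht0.comp hs) (hw.comp hs) (hu.comp hs) (hσ0.comp hs) (fun k => hρ _)
    (hρ0.comp hs) hne (fun k => hP _) (fun k => (hN _ (by omega)).1) (fun k => (hN _ (by omega)).2)

/-- Solutions near `x` exist for parameters near `p`, at a distance of the order of the
perturbation. -/
theorem exists_solution_norm_sub_le [FiniteDimensional ℝ Par]
    (hmul : DirectionalMultiplierCondition P f C p x) (hf : ContDiff ℝ 1 f) (hC : IsClosed C)
    (hmem : f (p, x) ∈ C) (hexact : HasExactTangents C (f (p, x)))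
    (hlin : ∀ w ∈ contingentCone P p, ∃ u : X,
      fderiv ℝ f (p, x) (w, u) ∈ contingentCone C (f (p, x))) :
    ∃ L : ℝ, 0 ≤ L ∧ ∃ δ > 0, ∀ p' ∈ P, ‖p' - p‖ < δ →
      ∃ x', f (p', x') ∈ C ∧ ‖x' - x‖ ≤ L * ‖p' - p‖ := by
  by_contra! hcon
  have h1 : ∀ k : ℕ, ∃ p' ∈ P, ‖p' - p‖ < 1 / ((k : ℝ) + 1) ∧
      ∀ x', f (p', x') ∈ C → (k : ℝ) * ‖p' - p‖ < ‖x' - x‖ := fun k =>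
    hcon k k.cast_nonneg _ (by positivity)
  choose a haP hap hafar using h1
  -- At the parameter `p` the point `x` itself is a solution, so `a k ≠ p`.
  have hapos : ∀ k, 0 < ‖a k - p‖ := by
    intro k
    by_contra! h0
    have h2 : a k = p := sub_eq_zero.1 (norm_le_zero_iff.1 h0)
    have := hafar k x (h2.symm ▸ hmem)
    simp [h2] at this
  have : ProperSpace Par := FiniteDimensional.proper ℝ Par
  obtain ⟨w₀, hw₀, φ, hφ, hlim⟩ := (isCompact_sphere (0 : Par) 1).tendsto_subseq
    (x := fun k => ‖a k - p‖⁻¹ • (a k - p))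
    (fun k => by simp [norm_smul, (hapos k).ne'])
  have hφ' := hφ.tendsto_atTop
  set t : ℕ → ℝ := fun k => ‖a (φ k) - p‖ with htdef
  set w : ℕ → Par := fun k => ‖a (φ k) - p‖⁻¹ • (a (φ k) - p) with hwdef
  have ht : ∀ k, 0 < t k := fun k => hapos _
  have ht0 : Tendsto t atTop (𝓝 0) :=
    squeeze_zero (fun k => (ht k).le) (fun k => (hap (φ k)).le)
      (tendsto_one_div_add_atTop_nhds_zero_nat.comp hφ')
  have hpw : ∀ k, p + t k • w k = a (φ k) := fun k => by
    simp [htdef, hwdef, smul_smul, (hapos (φ k)).ne']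
  have hw : Tendsto w atTop (𝓝 w₀) := hlim
  have hP : ∀ k, p + t k • w k ∈ P := fun k => hpw k ▸ haP _
  obtain ⟨u, hu⟩ := hlin w₀ ⟨t, w, ht, ht0, hw, hP⟩
  have hdiff : Differentiable ℝ f := hf.differentiable one_ne_zero
  have hq := (hdiff (p, x)).hasFDerivAt.tendsto_quotient ht ht0
    (hw.prodMk_nhds (tendsto_const_nhds (x := u)))
  set q : ℕ → Z := fun k => (t k)⁻¹ • (f ((p, x) + t k • (w k, u)) - f (p, x)) with hqdef
  set q₀ := fderiv ℝ f (p, x) (w₀, u)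
  have hfq : ∀ k, f (p + t k • w k, x + t k • u) = f (p, x) + t k • q k := fun k => by
    rw [hqdef]
    simp only [smul_smul, mul_inv_cancel₀ (ht k).ne', one_smul, Prod.smul_mk, Prod.mk_add_mk]
    abel
  -- The residual is below `e k * t k`, the added term making this strict; `e k` is shared equally
  -- between `ρ` and `σ` as two factors `√(e k)`.
  set e : ℕ → ℝ := fun k => ‖q k - q₀‖ + 1 / ((k : ℝ) + 1) with hedef
  have hepos : ∀ k, 0 < e k := fun k => by positivity
  have he0 : Tendsto e atTop (𝓝 0) := by
    have := (tendsto_iff_norm_sub_tendsto_zero.1 hq).add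
      (tendsto_one_div_add_atTop_nhds_zero_nat (𝕜 := ℝ))
    rwa [add_zero] at this
  have hs0 : Tendsto (fun k => √(e k)) atTop (𝓝 0) := by
    simpa using he0.sqrt
  refine hmul.not_eventually_far hf hC hmem (σ := fun k => √(e k)) (ρ := fun k => √(e k))
    (u := fun _ => u) (u₀ := u) ht ht0 hw tendsto_const_nhds hs0
    (fun k => Real.sqrt_pos.2 (hepos k)) hs0 ?_ hP ?_ ?_
  · intro h0
    rw [Prod.mk_eq_zero] at h0
    simp [h0.1] at hw₀
  · have hev := (tendsto_nhdsWithin_iff.2 ⟨ht0, Eventually.of_forall fun k => ht k⟩).eventually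
      (hexact q₀ hu)
    filter_upwards [hev] with k hk
    have h2 := Metric.infDist_le_dist_of_mem (x := f (p + t k • w k, x + t k • u)) hk
    rw [hfq k, dist_eq_norm, add_sub_add_left_eq_sub, ← smul_sub, norm_smul, Real.norm_eq_abs,
      abs_of_pos (ht k)] at h2
    rw [← mul_assoc, Real.mul_self_sqrt (hepos k).le, hfq k, mul_comm]
    refine h2.trans_lt ((mul_lt_mul_iff_right₀ (ht k)).2 ?_)
    have : (0 : ℝ) < 1 / ((k : ℝ) + 1) := by positivity
    linarith
  -- Solutions are more than `(‖u‖ + 1) * t k` away from `x`, hence more than `t k` away from `x + t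
  -- k • u`.
  · have hbig : Tendsto (fun k => (φ k : ℝ)) atTop atTop := tendsto_natCast_atTop_atTop.comp hφ'
    filter_upwards [hs0.eventually_lt_const one_pos, hbig.eventually_ge_atTop (‖u‖ + 1)]
      with k hk1 hk2 x' hx'
    rw [hpw k] at hx'
    have h2 := hafar _ x' hx'
    have h3 : ‖x' - x‖ ≤ ‖x' - (x + t k • u)‖ + ‖(x + t k • u) - x‖ :=
      norm_sub_le_norm_sub_add_norm_sub _ _ _
    rw [add_sub_cancel_left, norm_smul, Real.norm_eq_abs, abs_of_pos (ht k),
      norm_sub_rev x' (x + t k • u)] at h3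
    have h4 : √(e k) * t k < 1 * t k := mul_lt_mul_of_pos_right hk1 (ht k)
    have h5 : (‖u‖ + 1) * t k ≤ φ k * t k := mul_le_mul_of_nonneg_right hk2 (ht k).le
    have h6 : (φ k : ℝ) * t k < ‖x' - x‖ := h2
    linarith

/-- A violating sequence has residual `e` and distance to the solutions above `j ^ 2 * e` with `j →
∞`. With `σ * t = j * e` and `ρ = 2 / j` one has `ρ * σ * t = 2 * e > e`; one factor `j` makes `ρ`
vanish, the other makes `σ` vanish. -/
theorem robinsonStable_of_directionalMultiplierCondition [FiniteDimensional ℝ Par] {pbar : P}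
    (hmul : DirectionalMultiplierCondition P f C pbar x) (hf : ContDiff ℝ 1 f) (hC : IsClosed C)
    (hmem : f (pbar, x) ∈ C) (hexact : HasExactTangents C (f (pbar, x)))
    (hlin : ∀ w ∈ contingentCone P (pbar : Par), ∃ u : X,
      fderiv ℝ f (pbar, x) (w, u) ∈ contingentCone C (f (pbar, x))) :
    RobinsonStable (fun (p : P) ξ => f (p, ξ)) C pbar x := by
  obtain ⟨L, hL, δ, hδ, hsol⟩ := exists_solution_norm_sub_le hmul hf hC hmem hexact hlin
  have hCne : C.Nonempty := ⟨_, hmem⟩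
  by_contra hcon
  have h1 : ∀ k : ℕ, ∃ p' : P, ∃ ξ, ‖(p' : Par) - pbar‖ < 1 / ((k : ℝ) + 1) ∧
      ‖ξ - x‖ < 1 / ((k : ℝ) + 1) ∧ ∀ ξ', f (p', ξ') ∈ C →
        ((k : ℝ) + 1) ^ 2 * Metric.infDist (f (p', ξ)) C < ‖ξ - ξ'‖ := by
    intro k
    by_contra! hk
    have hpos : (0 : ℝ) < 1 / ((k : ℝ) + 1) := by positivity
    refine hcon ⟨((k : ℝ≥0) + 1) ^ 2, Metric.ball pbar (1 / ((k : ℝ) + 1)),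
      Metric.ball_mem_nhds _ hpos, Metric.ball x (1 / ((k : ℝ) + 1)),
      Metric.ball_mem_nhds _ hpos, fun p' hp' ξ hξ => ?_⟩
    obtain ⟨ξ', hξ', hle⟩ := hk p' ξ (by rwa [Metric.mem_ball, Subtype.dist_eq, dist_eq_norm] at hp')
      (by rwa [Metric.mem_ball, dist_eq_norm] at hξ)
    refine (Metric.infEDist_le_edist_of_mem (s := solutionMap _ C p') hξ').trans ?_
    rw [edist_dist, dist_eq_norm]
    refine (ENNReal.ofReal_le_ofReal hle).trans ?_
    rw [ENNReal.ofReal_mul (by positivity), Metric.infDist,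
      ENNReal.ofReal_toReal (Metric.infEDist_ne_top hCne)]
    gcongr
    rw [ENNReal.ofReal_pow (by positivity), ENNReal.ofReal_add (by positivity) zero_le_one]
    simp
  choose a ξ ha hξ hfar using h1
  set D : ℕ → Par × X := fun k => ((a k : Par) - pbar, ξ k - x) with hD
  have hinf : ∀ k, 0 < Metric.infDist (f (a k, ξ k)) C := by
    intro k
    refine (hC.notMem_iff_infDist_pos hCne).1 fun h => ?_
    have h2 := hfar k _ h
    rw [sub_self, norm_zero] at h2
    have h3 : 0 ≤ ((k : ℝ) + 1) ^ 2 * Metric.infDist (f (a k, ξ k)) C :=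
      mul_nonneg (by positivity) Metric.infDist_nonneg
    linarith
  have hDpos : ∀ k, 0 < ‖D k‖ := by
    intro k
    rw [norm_pos_iff]
    intro h0
    rw [hD, Prod.mk_eq_zero, sub_eq_zero, sub_eq_zero] at h0
    have h2 := hinf k
    rw [h0.1, h0.2, Metric.infDist_zero_of_mem hmem] at h2
    exact lt_irrefl _ h2
  have hD0 : Tendsto (fun k => ‖D k‖) atTop (𝓝 0) :=
    squeeze_zero (fun k => (hDpos k).le) (fun k => max_le (ha k).le (hξ k).le)
      tendsto_one_div_add_atTop_nhds_zero_nat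
  have : ProperSpace (Par × X) := FiniteDimensional.proper ℝ (Par × X)
  obtain ⟨⟨w₀, u₀⟩, hwu, φ, hφ, hlim⟩ := (isCompact_sphere (0 : Par × X) 1).tendsto_subseq
    (x := fun k => ‖D k‖⁻¹ • D k)
    (fun k => by simp [norm_smul, (hDpos k).ne'])
  have hφ' := hφ.tendsto_atTop
  set t : ℕ → ℝ := fun k => ‖D (φ k)‖ with htdef
  have ht : ∀ k, 0 < t k := fun k => hDpos _
  have ht0 : Tendsto t atTop (𝓝 0) := hD0.comp hφ'
  set w : ℕ → Par := fun k => (t k)⁻¹ • ((a (φ k) : Par) - pbar) with hwdef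
  set u : ℕ → X := fun k => (t k)⁻¹ • (ξ (φ k) - x) with hudef
  have hw : Tendsto w atTop (𝓝 w₀) := (continuous_fst.tendsto _).comp hlim
  have hu : Tendsto u atTop (𝓝 u₀) := (continuous_snd.tendsto _).comp hlim
  have hpw : ∀ k, (pbar : Par) + t k • w k = a (φ k) := fun k => by
    simp [hwdef, smul_smul, (ht k).ne']
  have hxu : ∀ k, x + t k • u k = ξ (φ k) := fun k => by
    simp [hudef, smul_smul, (ht k).ne']
  set e : ℕ → ℝ := fun k => Metric.infDist (f (a (φ k), ξ (φ k))) C with hedef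
  have hepos : ∀ k, 0 < e k := fun k => hinf _
  set j : ℕ → ℝ := fun k => (φ k : ℝ) + 1 with hjdef
  have hjpos : ∀ k, 0 < j k := fun k => by positivity
  have hj1 : ∀ k, 1 ≤ j k := fun k => by simp [hjdef]
  have hj0 : ∀ c : ℝ, Tendsto (fun k => c / j k) atTop (𝓝 0) := fun c => by
    have := (tendsto_one_div_add_atTop_nhds_zero_nat (𝕜 := ℝ)).const_mul c |>.comp hφ'
    simp only [mul_zero] at this
    refine this.congr fun k => ?_
    simp [hjdef, div_eq_mul_inv]
  have hfar' : ∀ k, ∀ ξ', f (a (φ k), ξ') ∈ C → j k ^ 2 * e k < ‖ξ (φ k) - ξ'‖ := fun k => hfar _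
  -- Comparison with the solution near `x` from `exists_solution_norm_sub_le`; it yields `σ ≤ (1 +
  -- L) / j`.
  have hgap : ∀ᶠ k in atTop, j k ^ 2 * e k ≤ (1 + L) * t k := by
    have hpt : Tendsto (fun k => 1 / ((φ k : ℝ) + 1)) atTop (𝓝 0) := hj0 1
    filter_upwards [hpt.eventually_lt_const hδ] with k hk
    obtain ⟨ξ', hξ', hle⟩ := hsol (a (φ k)) (a (φ k)).2 ((ha _).trans hk)
    refine (hfar' k ξ' hξ').le.trans ?_
    have h2 : ‖ξ (φ k) - ξ'‖ ≤ ‖ξ (φ k) - x‖ + ‖x - ξ'‖ := norm_sub_le_norm_sub_add_norm_sub _ _ _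
    have h3 : ‖ξ (φ k) - x‖ ≤ t k := le_max_right _ _
    have h4 : ‖(a (φ k) : Par) - pbar‖ ≤ t k := le_max_left _ _
    have h5 : L * ‖(a (φ k) : Par) - pbar‖ ≤ L * t k := mul_le_mul_of_nonneg_left h4 hL
    rw [norm_sub_rev x] at h2
    linarith
  have hσt : ∀ k, j k * e k / t k * t k = j k * e k := fun k => div_mul_cancel₀ _ (ht k).ne'
  refine hmul.not_eventually_far hf hC hmem (t := t) (σ := fun k => j k * e k / t k)
    (ρ := fun k => 2 / j k) (w₀ := w₀) (u₀ := u₀) ht ht0 hw hu ?_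
    (fun k => div_pos two_pos (hjpos k)) (hj0 2) ?_ (fun k => by rw [hpw]; exact (a (φ k)).2) ?_ ?_
  · refine squeeze_zero' (Eventually.of_forall fun k =>
      (div_pos (mul_pos (hjpos k) (hepos k)) (ht k)).le) ?_ (hj0 (1 + L))
    filter_upwards [hgap] with k hk
    rw [div_le_div_iff₀ (ht k) (hjpos k)]
    linarith
  · intro h0
    rw [mem_sphere_zero_iff_norm, h0, norm_zero] at hwu
    exact zero_ne_one hwu
  · refine Eventually.of_forall fun k => ?_
    rw [hpw, hxu, hσt, ← mul_assoc, div_mul_cancel₀ _ (hjpos k).ne']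
    have := hepos k
    change e k < 2 * e k
    linarith
  · refine Eventually.of_forall fun k x' hx' => ?_
    rw [hpw] at hx'
    rw [hxu, hσt]
    refine lt_of_le_of_lt ?_ (hfar' k x' hx')
    rw [sq, mul_assoc]
    exact le_mul_of_one_le_left (mul_pos (hjpos k) (hepos k)).le (hj1 k)

end Abstract

/-! ### From Robinson stability to the Aubin property. -/

/-- Robinson stability yields the Lipschitz-like property of the solution map. -/
theorem RobinsonStable.lipschitzLike {Par X Z : Type*} [NormedAddCommGroup Par]
    [NormedSpace ℝ Par] [NormedAddCommGroup X] [NormedSpace ℝ X] [FiniteDimensional ℝ X]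
    [NormedAddCommGroup Z] [NormedSpace ℝ Z] {P : Set Par} {f : Par × X → Z} {C : Set Z}
    {pbar : P} {x : X} (hf : ContDiff ℝ 1 f) (hC : IsClosed C)
    (h : RobinsonStable (fun (p : P) ξ => f (p, ξ)) C pbar x) :
    LipschitzLike (solutionMap (fun (p : P) ξ => f (p, ξ)) C) pbar x := by
  obtain ⟨κ, V, hV, U, hU, hrob⟩ := h
  obtain ⟨K, W, hW, hK⟩ := (hf.contDiffAt (x := ((pbar : Par), x))).exists_lipschitzOnWith
  obtain ⟨A, hA, B, hB, hAB⟩ := mem_nhds_prod_iff.1 hW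
  refine ⟨κ * K, by positivity, V ∩ Subtype.val ⁻¹' A,
    inter_mem hV (continuous_subtype_val.continuousAt hA), U ∩ B, inter_mem hU hB, ?_⟩
  rintro p' ⟨hp'V, hp'A⟩ p'' ⟨hp''V, hp''A⟩ ξ ⟨hξ, hξU, hξB⟩
  have : ProperSpace X := FiniteDimensional.proper ℝ X
  -- Since `f (p', ξ) ∈ C`, the residual at `p''` is at most the change of `f` between the two
  -- parameters.
  have hle : Metric.infEDist ξ (solutionMap (fun (p : P) ξ => f (p, ξ)) C p'') ≤
      ENNReal.ofReal (κ * K * dist p' p'') := by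
    refine (hrob p'' hp''V ξ hξU).trans ?_
    have h1 : Metric.infEDist (f (p'', ξ)) C ≤ edist (f (p'', ξ)) (f (p', ξ)) :=
      Metric.infEDist_le_edist_of_mem hξ
    have h2 := hK (x := ((p'' : Par), ξ)) (hAB ⟨hp''A, hξB⟩) (y := ((p' : Par), ξ))
      (hAB ⟨hp'A, hξB⟩)
    have h3 : edist ((p'' : Par), ξ) ((p' : Par), ξ) = ENNReal.ofReal (dist p' p'') := by
      rw [Prod.edist_eq]
      simp only [edist_self]
      rw [max_eq_left zero_le, edist_comm, edist_dist, Subtype.dist_eq]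
    rw [h3] at h2
    rw [mul_assoc, ENNReal.ofReal_mul κ.coe_nonneg, ENNReal.ofReal_mul K.coe_nonneg, ENNReal.ofReal_coe_nnreal,
      ENNReal.ofReal_coe_nnreal]
    gcongr
    exact h1.trans h2
  -- A finite extended distance excludes the empty set; nearest solutions then exist by closedness.
  have hne : (solutionMap (fun (p : P) ξ => f (p, ξ)) C p'').Nonempty := by
    rw [Set.nonempty_iff_ne_empty]
    intro h0
    rw [h0, Metric.infEDist_empty, top_le_iff] at hle
    exact ENNReal.ofReal_ne_top hle
  have hclosed : IsClosed (solutionMap (fun (p : P) ξ => f (p, ξ)) C p'') :=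
    hC.preimage (hf.continuous.comp (by fun_prop : Continuous fun ξ : X => ((p'' : Par), ξ)))
  obtain ⟨x', hx', hdist⟩ := hclosed.exists_infDist_eq_dist hne ξ
  refine ⟨x', hx', ?_⟩
  rw [← dist_eq_norm, ← hdist, Metric.infDist]
  exact ENNReal.toReal_le_of_le_ofReal (by positivity) hle

/-! ### Complementarity geometry of the orthant. -/

/-- Regular normals to the nonpositive orthant. -/
theorem mem_regularNormalCone_nonposOrthant {l : ℕ} {s y : Vec l} (hs : s ∈ nonposOrthant l)
    (hy : y ∈ regularNormalCone (nonposOrthant l) s) (i : Fin l) : 0 ≤ y i ∧ s i * y i = 0 := by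
  have ht : Tendsto (fun k : ℕ => 1 / ((k : ℝ) + 1)) atTop (𝓝 0) :=
    tendsto_one_div_add_atTop_nhds_zero_nat
  have hseg : ∀ u : Vec l, s + u ∈ nonposOrthant l →
      u ∈ contingentCone (nonposOrthant l) s := by
    intro u hu
    refine ⟨fun k => 1 / ((k : ℝ) + 1), fun _ => u, fun k => by positivity, ht,
      tendsto_const_nhds, fun k j => ?_⟩
    have h1 := hs j
    have h2 : s j + u j ≤ 0 := hu j
    have h3 : (0 : ℝ) < 1 / ((k : ℝ) + 1) := by positivity
    have h4 : 1 / ((k : ℝ) + 1) ≤ 1 := by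
      rw [div_le_one (by positivity)]
      simp
    change s j + 1 / ((k : ℝ) + 1) * u j ≤ 0
    nlinarith
  have hneg : ∀ a : ℝ, s i + a ≤ 0 → y i * a ≤ 0 := by
    intro a ha
    have h1 := hy (EuclideanSpace.single i a) (hseg _ fun j => ?_)
    · rw [real_inner_comm, EuclideanSpace.inner_single_left] at h1
      simpa [mul_comm] using h1
    · by_cases hj : j = i
      · subst hj
        simpa using ha
      · simpa [hj] using hs j
  -- The shift `-1` gives the sign of `y i`; the shift `-s i`, up to the boundary, gives
  -- complementarity.
  have h1 := hneg (-1) (by linarith [hs i])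
  have h2 := hneg (-s i) (by linarith)
  have h3 : 0 ≤ y i := by linarith
  exact ⟨h3, le_antisymm (mul_nonpos_of_nonpos_of_nonneg (hs i) h3) (by linarith)⟩

/-- Complementarity description of the graph of the normal cone mapping of the orthant. -/
theorem mem_graphNormalOrthant_iff {l : ℕ} {a : WithLp 2 (Vec l × Vec l)} :
    a ∈ graphNormalOrthant l ↔ ∀ i, a.fst i ≤ 0 ∧ 0 ≤ a.snd i ∧ a.fst i * a.snd i = 0 := by
  constructor
  · rintro ⟨hs, b, c, hb, hc, hmem⟩ i
    have hbi : Tendsto (fun k => b k i) atTop (𝓝 (a.fst i)) :=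
      ((EuclideanSpace.proj i : Vec l →L[ℝ] ℝ).continuous.tendsto _).comp hb
    have hci : Tendsto (fun k => c k i) atTop (𝓝 (a.snd i)) :=
      ((EuclideanSpace.proj i : Vec l →L[ℝ] ℝ).continuous.tendsto _).comp hc
    have h := fun k => mem_regularNormalCone_nonposOrthant (hmem k).1 (hmem k).2 i
    refine ⟨hs i, ge_of_tendsto' hci fun k => (h k).1, ?_⟩
    refine tendsto_nhds_unique (hbi.mul hci) ?_
    simp only [fun k => (h k).2]
    exact tendsto_const_nhds
  · intro h
    refine ⟨fun i => (h i).1, fun _ => a.fst, fun _ => a.snd, tendsto_const_nhds,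
      tendsto_const_nhds, fun _ => ⟨fun i => (h i).1, ?_⟩⟩
    rintro u ⟨t, s, ht, ht0, hs, hmem⟩
    rw [real_inner_comm, PiLp.inner_apply]
    refine Finset.sum_nonpos fun i _ => ?_
    obtain ⟨h1, h2, h3⟩ := h i
    have hsi : Tendsto (fun k => s k i) atTop (𝓝 (u i)) :=
      ((EuclideanSpace.proj i : Vec l →L[ℝ] ℝ).continuous.tendsto _).comp hs
    change a.snd i * u i ≤ 0
    rcases mul_eq_zero.1 h3 with h0 | h0
    · refine mul_nonpos_of_nonneg_of_nonpos h2 (le_of_tendsto' hsi fun k => ?_)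
      have h4 : a.fst i + t k * s k i ≤ 0 := hmem k i
      rw [h0, zero_add] at h4
      exact nonpos_of_mul_nonpos_right h4 (ht k)
    · simp [h0]

theorem isClosed_graphNormalOrthant (l : ℕ) : IsClosed (graphNormalOrthant l) := by
  have h : graphNormalOrthant l = {a : WithLp 2 (Vec l × Vec l) |
      ∀ i, a.fst i ≤ 0 ∧ 0 ≤ a.snd i ∧ a.fst i * a.snd i = 0} :=
    Set.ext fun _ => mem_graphNormalOrthant_iff
  rw [h, Set.ofPred_forall]
  refine isClosed_iInter fun i => ?_
  have h1 : Continuous fun a : WithLp 2 (Vec l × Vec l) => a.fst i := by fun_prop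
  have h2 : Continuous fun a : WithLp 2 (Vec l × Vec l) => a.snd i := by fun_prop
  exact (isClosed_le h1 continuous_const).inter
    ((isClosed_le continuous_const h2).inter (isClosed_eq (h1.mul h2) continuous_const))

/-- Tangents to the complementarity angle `{(s, y) | s ≤ 0 ≤ y, s y = 0}` are directions of
segments in it. -/
theorem eventually_complementary {s y σ η : ℝ} {t a b : ℕ → ℝ} (ht : ∀ k, 0 < t k)
    (ht0 : Tendsto t atTop (𝓝 0)) (ha : Tendsto a atTop (𝓝 σ)) (hb : Tendsto b atTop (𝓝 η))
    (h0 : s ≤ 0 ∧ 0 ≤ y ∧ s * y = 0)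
    (h : ∀ k, s + t k * a k ≤ 0 ∧ 0 ≤ y + t k * b k ∧ (s + t k * a k) * (y + t k * b k) = 0) :
    ∀ᶠ r : ℝ in 𝓝[>] 0, s + r * σ ≤ 0 ∧ 0 ≤ y + r * η ∧ (s + r * σ) * (y + r * η) = 0 := by
  obtain ⟨hs, hy, hsy⟩ := h0
  have hlim : ∀ c d : ℝ, Tendsto (fun r : ℝ => c + r * d) (𝓝[>] 0) (𝓝 c) := by
    intro c d
    have : Continuous fun r : ℝ => c + r * d := by fun_prop
    simpa using (this.tendsto 0).mono_left nhdsWithin_le_nhds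
  have hta : Tendsto (fun k => s + t k * a k) atTop (𝓝 s) := by
    simpa using (ht0.mul ha).const_add s
  have htb : Tendsto (fun k => y + t k * b k) atTop (𝓝 y) := by
    simpa using (ht0.mul hb).const_add y
  -- Off the corner the angle is locally a line, so one coordinate of the direction vanishes; at the
  -- corner it is a closed cone.
  rcases hs.lt_or_eq with hs' | rfl
  · have hy0 : y = 0 := (mul_eq_zero.1 hsy).resolve_left hs'.ne
    subst hy0
    have hb0 : ∀ᶠ k in atTop, b k = 0 := by
      filter_upwards [hta.eventually_lt_const hs'] with k hk
      have h1 := (mul_eq_zero.1 (h k).2.2).resolve_left hk.ne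
      rw [zero_add] at h1
      exact (mul_eq_zero.1 h1).resolve_left (ht k).ne'
    have hη : η = 0 := tendsto_nhds_unique hb (tendsto_const_nhds.congr' (hb0.mono fun _ h => h.symm))
    subst hη
    filter_upwards [(hlim s σ).eventually_lt_const hs'] with r hr
    simp [hr.le]
  · rcases hy.lt_or_eq with hy' | rfl
    · have ha0 : ∀ᶠ k in atTop, a k = 0 := by
        filter_upwards [htb.eventually_const_lt hy'] with k hk
        have h1 := (mul_eq_zero.1 (h k).2.2).resolve_right hk.ne'
        rw [zero_add] at h1
        exact (mul_eq_zero.1 h1).resolve_left (ht k).ne'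
      have hσ : σ = 0 :=
        tendsto_nhds_unique ha (tendsto_const_nhds.congr' (ha0.mono fun _ h => h.symm))
      subst hσ
      filter_upwards [(hlim y η).eventually_const_lt hy'] with r hr
      simp [hr.le]
    · simp only [zero_add] at h ⊢
      have h1 : σ ≤ 0 := le_of_tendsto' ha fun k => nonpos_of_mul_nonpos_right (h k).1 (ht k)
      have h2 : 0 ≤ η := ge_of_tendsto' hb fun k => nonneg_of_mul_nonneg_right (h k).2.1 (ht k)
      have h3 : σ * η = 0 := by
        refine tendsto_nhds_unique (ha.mul hb) ?_
        have h4 : ∀ k, a k * b k = 0 := by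
          intro k
          have := (h k).2.2
          simpa [(ht k).ne'] using this
        simp only [h4]
        exact tendsto_const_nhds
      filter_upwards [self_mem_nhdsWithin] with r hr
      have hr' : 0 < r := hr
      refine ⟨mul_nonpos_of_nonneg_of_nonpos hr'.le h1, mul_nonneg hr'.le h2, ?_⟩
      rw [mul_mul_mul_comm, h3, mul_zero]

theorem hasExactTangents_graphNormalOrthant {l : ℕ} {a : WithLp 2 (Vec l × Vec l)}
    (ha : a ∈ graphNormalOrthant l) : HasExactTangents (graphNormalOrthant l) a := by
  rintro v ⟨t, s, ht, ht0, hs, hmem⟩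
  simp only [mem_graphNormalOrthant_iff] at ha hmem ⊢
  refine eventually_all.2 fun i => ?_
  have h1 : Continuous fun a : WithLp 2 (Vec l × Vec l) => a.fst i := by fun_prop
  have h2 : Continuous fun a : WithLp 2 (Vec l × Vec l) => a.snd i := by fun_prop
  exact eventually_complementary ht ht0 ((h1.tendsto v).comp hs) ((h2.tendsto v).comp hs) (ha i)
    fun k => hmem k i

/-! ### Tangents and normals of the KKT set. -/

section KKT

variable {m n l : ℕ}

theorem isClosed_kktSet (n l : ℕ) : IsClosed (kktSet n l) := by
  have h1 : Continuous fun c : WithLp 2 (Vec n × WithLp 2 (Vec l × Vec l)) => c.fst := by fun_prop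
  have h2 : Continuous fun c : WithLp 2 (Vec n × WithLp 2 (Vec l × Vec l)) => c.snd := by fun_prop
  exact (isClosed_eq h1 continuous_const).inter ((isClosed_graphNormalOrthant l).preimage h2)

theorem mem_contingentCone_kktSet_iff {c v : WithLp 2 (Vec n × WithLp 2 (Vec l × Vec l))}
    (hc : c.fst = 0) : v ∈ contingentCone (kktSet n l) c ↔
      v.fst = 0 ∧ v.snd ∈ contingentCone (graphNormalOrthant l) c.snd := by
  have h1 : Continuous fun c : WithLp 2 (Vec n × WithLp 2 (Vec l × Vec l)) => c.fst := by fun_prop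
  have h2 : Continuous fun c : WithLp 2 (Vec n × WithLp 2 (Vec l × Vec l)) => c.snd := by fun_prop
  constructor
  · rintro ⟨t, s, ht, ht0, hs, hmem⟩
    refine ⟨?_, t, fun k => (s k).snd, ht, ht0, (h2.tendsto v).comp hs, fun k => (hmem k).2⟩
    have h3 : ∀ k, (s k).fst = 0 := by
      intro k
      have h4 : c.fst + t k • (s k).fst = 0 := (hmem k).1
      rw [hc, zero_add] at h4
      exact (smul_eq_zero.1 h4).resolve_left (ht k).ne'
    refine tendsto_nhds_unique ((h1.tendsto v).comp hs) ?_
    simp only [Function.comp_def, h3]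
    exact tendsto_const_nhds
  · rintro ⟨hv, t, s, ht, ht0, hs, hmem⟩
    have h3 : Continuous fun r : WithLp 2 (Vec l × Vec l) =>
        (WithLp.toLp 2 ((0 : Vec n), r) : WithLp 2 (Vec n × WithLp 2 (Vec l × Vec l))) := by
      fun_prop
    have h4 : v = WithLp.toLp 2 (0, v.snd) := by
      rw [← hv]
      rfl
    rw [h4]
    refine ⟨t, fun k => WithLp.toLp 2 (0, s k), ht, ht0, (h3.tendsto _).comp hs,
      fun k => ⟨?_, hmem k⟩⟩
    change c.fst + t k • (0 : Vec n) = 0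
    rw [hc, smul_zero, zero_add]

theorem hasExactTangents_kktSet {c : WithLp 2 (Vec n × WithLp 2 (Vec l × Vec l))}
    (hc : c ∈ kktSet n l) : HasExactTangents (kktSet n l) c := by
  intro v hv
  rw [mem_contingentCone_kktSet_iff hc.1] at hv
  filter_upwards [hasExactTangents_graphNormalOrthant hc.2 v.snd hv.2] with r hr
  refine ⟨?_, hr⟩
  change c.fst + r • v.fst = 0
  rw [hc.1, hv.1, smul_zero, zero_add]

/-- Tangents have zero first component, so testing with `(0, u)` isolates the second component of
the normal; the first is unrestricted. -/
theorem snd_mem_regularNormalCone {c v : WithLp 2 (Vec n × WithLp 2 (Vec l × Vec l))}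
    (hc : c ∈ kktSet n l) (hv : v ∈ regularNormalCone (kktSet n l) c) :
    v.snd ∈ regularNormalCone (graphNormalOrthant l) c.snd := by
  intro u hu
  have h := hv (WithLp.toLp 2 (0, u)) ((mem_contingentCone_kktSet_iff hc.1).2 ⟨rfl, hu⟩)
  simpa [WithLp.prod_inner_apply] using h

theorem snd_mem_directionalNormalCone {c w v : WithLp 2 (Vec n × WithLp 2 (Vec l × Vec l))}
    (hv : v ∈ directionalNormalCone (kktSet n l) c w) :
    v.snd ∈ directionalNormalCone (graphNormalOrthant l) c.snd w.snd := by
  have h2 : Continuous fun c : WithLp 2 (Vec n × WithLp 2 (Vec l × Vec l)) => c.snd := by fun_prop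
  obtain ⟨t, s, b, ht, ht0, hs, hb, hmem⟩ := hv
  have hs2 : Tendsto (fun k => (s k).snd) atTop (𝓝 w.snd) := (h2.tendsto w).comp hs
  have hb2 : Tendsto (fun k => (b k).snd) atTop (𝓝 v.snd) := (h2.tendsto v).comp hb
  refine ⟨t, fun k => (s k).snd, fun k => (b k).snd, ht, ht0, hs2, hb2, fun k => ?_⟩
  have hsnd : (c + t k • s k).snd = c.snd + t k • (s k).snd := rfl
  have h3 := (hmem k).1.2
  have h4 := snd_mem_regularNormalCone (hmem k).1 (hmem k).2
  rw [hsnd] at h3 h4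
  exact ⟨h3, h4⟩

end KKT

/-! ### Derivatives of the KKT map and the adjoint system. -/

section KKTDerivative

variable {m n l : ℕ} {F : Vec m → Vec n → Vec n} {φ : Vec m → Vec n → Vec l}

theorem hasFDerivAt_toLp_prodMk {D E G : Type*} [NormedAddCommGroup D] [NormedSpace ℝ D]
    [NormedAddCommGroup E] [NormedSpace ℝ E] [NormedAddCommGroup G] [NormedSpace ℝ G]
    {a : D → E} {b : D → G} {a' : D →L[ℝ] E} {b' : D →L[ℝ] G} {q : D}
    (ha : HasFDerivAt a a' q) (hb : HasFDerivAt b b' q) :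
    HasFDerivAt (fun r => WithLp.toLp 2 (a r, b r))
      (((WithLp.prodContinuousLinearEquiv 2 ℝ E G).symm : E × G →L[ℝ] WithLp 2 (E × G)).comp
        (a'.prod b')) q :=
  ((WithLp.prodContinuousLinearEquiv 2 ℝ E G).symm : E × G →L[ℝ] WithLp 2 (E × G)).hasFDerivAt.comp
    q (ha.prodMk hb)

theorem fderiv_toLp_toLp_apply {A X Y E G : Type*} [NormedAddCommGroup A] [NormedSpace ℝ A]
    [NormedAddCommGroup X] [NormedSpace ℝ X] [NormedAddCommGroup Y] [NormedSpace ℝ Y]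
    [NormedAddCommGroup E] [NormedSpace ℝ E] [NormedAddCommGroup G] [NormedSpace ℝ G]
    {a : A × WithLp 2 (X × Y) → E} {b : A × X → G} {p : A} {ξ : WithLp 2 (X × Y)}
    (ha : DifferentiableAt ℝ a (p, ξ)) (hb : DifferentiableAt ℝ b (p, ξ.fst))
    (w : A) (ζ : WithLp 2 (X × Y)) :
    fderiv ℝ (fun q : A × WithLp 2 (X × Y) =>
        WithLp.toLp 2 (a q, WithLp.toLp 2 (b (q.1, q.2.fst), q.2.snd))) (p, ξ) (w, ζ) =
      WithLp.toLp 2 (fderiv ℝ a (p, ξ) (w, ζ),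
        WithLp.toLp 2 (fderiv ℝ b (p, ξ.fst) (w, ζ.fst), ζ.snd)) := by
  have h2 : HasFDerivAt (fun q : A × WithLp 2 (X × Y) => b (q.1, q.2.fst))
      ((fderiv ℝ b (p, ξ.fst)).comp ((ContinuousLinearMap.fst ℝ _ _).prod
        ((WithLp.fstL 2 ℝ X Y).comp (ContinuousLinearMap.snd ℝ _ _)))) (p, ξ) :=
    HasFDerivAt.comp (g := b) (p, ξ) hb.hasFDerivAt
      ((ContinuousLinearMap.fst ℝ A _).prod ((WithLp.fstL 2 ℝ X Y).comp
        (ContinuousLinearMap.snd ℝ _ _))).hasFDerivAt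
  have h3 : HasFDerivAt (fun q : A × WithLp 2 (X × Y) => q.2.snd)
      ((WithLp.sndL 2 ℝ X Y).comp (ContinuousLinearMap.snd ℝ _ _)) (p, ξ) :=
    ((WithLp.sndL 2 ℝ X Y).comp (ContinuousLinearMap.snd ℝ A _)).hasFDerivAt
  rw [(hasFDerivAt_toLp_prodMk ha.hasFDerivAt (hasFDerivAt_toLp_prodMk h2 h3)).fderiv]
  rfl

theorem contDiff_toLp_prodMk {D E G : Type*} [NormedAddCommGroup D] [NormedSpace ℝ D]
    [NormedAddCommGroup E] [NormedSpace ℝ E] [NormedAddCommGroup G] [NormedSpace ℝ G]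
    {a : D → E} {b : D → G} {k : WithTop ℕ∞} (ha : ContDiff ℝ k a) (hb : ContDiff ℝ k b) :
    ContDiff ℝ k (fun r => WithLp.toLp 2 (a r, b r)) :=
  (WithLp.prodContinuousLinearEquiv 2 ℝ E G).symm.contDiff.comp (ha.prodMk hb)

theorem contDiff_adjoint {E G : Type*} [NormedAddCommGroup E] [InnerProductSpace ℝ E]
    [FiniteDimensional ℝ E] [NormedAddCommGroup G] [InnerProductSpace ℝ G]
    [FiniteDimensional ℝ G] [CompleteSpace E] [CompleteSpace G] {k : WithTop ℕ∞} :
    ContDiff ℝ k fun A : E →L[ℝ] G => ContinuousLinearMap.adjoint A :=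
  (LinearMap.toContinuousLinearMap
    { toFun := fun A : E →L[ℝ] G => ContinuousLinearMap.adjoint A
      map_add' := fun A B => by simp
      map_smul' := fun r A => by simp } : (E →L[ℝ] G) →L[ℝ] (G →L[ℝ] E)).contDiff

/-- The Lagrangian as a function of the parameter and the primal-dual pair. -/
noncomputable def lagrangianPair (F : Vec m → Vec n → Vec n) (φ : Vec m → Vec n → Vec l)
    (q : Vec m × WithLp 2 (Vec n × Vec l)) : Vec n :=
  lagrangian F φ q.1 q.2.fst q.2.snd

/-- The KKT map as a function of the parameter and the primal-dual pair. -/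
noncomputable def kktPair (F : Vec m → Vec n → Vec n) (φ : Vec m → Vec n → Vec l)
    (q : Vec m × WithLp 2 (Vec n × Vec l)) : WithLp 2 (Vec n × WithLp 2 (Vec l × Vec l)) :=
  WithLp.toLp 2 (lagrangianPair F φ q, WithLp.toLp 2 (φ q.1 q.2.fst, q.2.snd))

theorem hasFDerivAt_partial (hφ : ContDiff ℝ 2 (Function.uncurry φ)) (p : Vec m) (x : Vec n) :
    HasFDerivAt (φ p) ((fderiv ℝ (Function.uncurry φ) (p, x)).comp
      (ContinuousLinearMap.inr ℝ (Vec m) (Vec n))) x :=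
  ((hφ.differentiable two_ne_zero) (p, x)).hasFDerivAt.comp x (hasFDerivAt_prodMk_right p x)

theorem contDiff_paramPrimal {k : WithTop ℕ∞} :
    ContDiff ℝ k fun q : Vec m × WithLp 2 (Vec n × Vec l) => (q.1, q.2.fst) :=
  contDiff_fst.prodMk ((WithLp.fstL 2 ℝ (Vec n) (Vec l)).contDiff.comp contDiff_snd)

theorem contDiff_lagrangianPair (hF : ContDiff ℝ 1 (Function.uncurry F))
    (hφ : ContDiff ℝ 2 (Function.uncurry φ)) : ContDiff ℝ 1 (lagrangianPair F φ) := by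
  have h1 : ContDiff ℝ 1 fun q : Vec m × WithLp 2 (Vec n × Vec l) => F q.1 q.2.fst :=
    hF.comp contDiff_paramPrimal
  have h2 : ContDiff ℝ 1 fun q : Vec m × WithLp 2 (Vec n × Vec l) =>
      fderiv ℝ (Function.uncurry φ) (q.1, q.2.fst) :=
    (hφ.fderiv_right (m := 1) (by norm_num)).comp contDiff_paramPrimal
  have h3 : ContDiff ℝ 1 fun q : Vec m × WithLp 2 (Vec n × Vec l) =>
      partialGradAdjoint φ q.1 q.2.fst := by
    simp only [partialGradAdjoint, (hasFDerivAt_partial hφ _ _).fderiv]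
    exact contDiff_adjoint.comp (h2.clm_comp contDiff_const)
  exact h1.add (h3.clm_apply ((WithLp.sndL 2 ℝ (Vec n) (Vec l)).contDiff.comp contDiff_snd))

theorem contDiff_kktPair (hF : ContDiff ℝ 1 (Function.uncurry F))
    (hφ : ContDiff ℝ 2 (Function.uncurry φ)) : ContDiff ℝ 1 (kktPair F φ) :=
  contDiff_toLp_prodMk (contDiff_lagrangianPair hF hφ)
    (contDiff_toLp_prodMk ((hφ.of_le one_le_two).comp contDiff_paramPrimal)
      ((WithLp.sndL 2 ℝ (Vec n) (Vec l)).contDiff.comp contDiff_snd))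

/-- The total derivative is the sum of its three partial ones; in `y` the Lagrangian is affine with
linear part `partialGradAdjoint φ p x`. -/
theorem fderiv_lagrangianPair_apply (hF : ContDiff ℝ 1 (Function.uncurry F))
    (hφ : ContDiff ℝ 2 (Function.uncurry φ)) (p : Vec m) (x : Vec n) (y : Vec l) (w : Vec m)
    (u : Vec n) (v : Vec l) :
    fderiv ℝ (lagrangianPair F φ) (p, WithLp.toLp 2 (x, y)) (w, WithLp.toLp 2 (u, v)) =
      fderiv ℝ (fun p' => lagrangian F φ p' x y) p w
        + fderiv ℝ (fun x' => lagrangian F φ p x' y) x u + partialGradAdjoint φ p x v := by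
  have hd := ((contDiff_lagrangianPair hF hφ).differentiable one_ne_zero
    (p, WithLp.toLp 2 (x, y))).hasFDerivAt
  set Λ := fderiv ℝ (lagrangianPair F φ) (p, WithLp.toLp 2 (x, y))
  have h1 := HasFDerivAt.comp (f := fun p' => (p', WithLp.toLp 2 (x, y))) p hd
    (hasFDerivAt_prodMk_left p _)
  have h2 := hd.comp x ((hasFDerivAt_prodMk_right p (WithLp.toLp 2 (x, y))).comp x
    (hasFDerivAt_toLp_prodMk (hasFDerivAt_id x) (hasFDerivAt_const y x)))
  have h3 := hd.comp y ((hasFDerivAt_prodMk_right p (WithLp.toLp 2 (x, y))).comp y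
    (hasFDerivAt_toLp_prodMk (hasFDerivAt_const x y) (hasFDerivAt_id y)))
  have h4 : HasFDerivAt (fun y' => lagrangian F φ p x y') (partialGradAdjoint φ p x) y :=
    (partialGradAdjoint φ p x).hasFDerivAt.const_add (F p x)
  have e1 : fderiv ℝ (fun p' => lagrangian F φ p' x y) p w = Λ (w, 0) :=
    DFunLike.congr_fun (HasFDerivAt.fderiv h1) w
  have e2 : fderiv ℝ (fun x' => lagrangian F φ p x' y) x u = Λ (0, WithLp.toLp 2 (u, 0)) :=
    DFunLike.congr_fun (HasFDerivAt.fderiv h2) u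
  have e3 : partialGradAdjoint φ p x v = Λ (0, WithLp.toLp 2 (0, v)) :=
    DFunLike.congr_fun (h4.unique h3) v
  rw [e1, e2, e3, ← map_add, ← map_add]
  congr 1
  refine Prod.ext (by simp) ?_
  apply (WithLp.prodContinuousLinearEquiv 2 ℝ (Vec n) (Vec l)).injective
  refine Prod.ext ?_ ?_ <;> simp

theorem fderiv_kktPair_apply (hF : ContDiff ℝ 1 (Function.uncurry F))
    (hφ : ContDiff ℝ 2 (Function.uncurry φ)) (p : Vec m) (x : Vec n) (y : Vec l) (w : Vec m)
    (u : Vec n) (v : Vec l) :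
    fderiv ℝ (kktPair F φ) (p, WithLp.toLp 2 (x, y)) (w, WithLp.toLp 2 (u, v)) =
      WithLp.toLp 2 (fderiv ℝ (fun p' => lagrangian F φ p' x y) p w
        + fderiv ℝ (fun x' => lagrangian F φ p x' y) x u + partialGradAdjoint φ p x v,
        WithLp.toLp 2 (fderiv ℝ (Function.uncurry φ) (p, x) (w, u), v)) := by
  rw [← fderiv_lagrangianPair_apply hF hφ]
  exact fderiv_toLp_toLp_apply ((contDiff_lagrangianPair hF hφ).differentiable one_ne_zero _)
    (hφ.differentiable two_ne_zero _) _ _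

theorem fderiv_kktPair_mem_iff (hF : ContDiff ℝ 1 (Function.uncurry F))
    (hφ : ContDiff ℝ 2 (Function.uncurry φ)) {p : Vec m} {x : Vec n} {y : Vec l} {w : Vec m}
    {u : Vec n} {v : Vec l} (hmem : kktPair F φ (p, WithLp.toLp 2 (x, y)) ∈ kktSet n l) :
    fderiv ℝ (kktPair F φ) (p, WithLp.toLp 2 (x, y)) (w, WithLp.toLp 2 (u, v)) ∈
      contingentCone (kktSet n l) (kktPair F φ (p, WithLp.toLp 2 (x, y))) ↔
      LinearizedKKT F φ p x y w u v := by
  rw [mem_contingentCone_kktSet_iff hmem.1, fderiv_kktPair_apply hF hφ]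
  rfl

theorem adjointKKT_of_mem_directionalNormalCone (hF : ContDiff ℝ 1 (Function.uncurry F))
    (hφ : ContDiff ℝ 2 (Function.uncurry φ)) {p : Vec m} {x : Vec n} {y : Vec l} {w : Vec m}
    {u : Vec n} {v : Vec l} {z : Vec n} {lam d : Vec l}
    (hnormal : WithLp.toLp 2 (z, WithLp.toLp 2 (lam, d)) ∈ directionalNormalCone (kktSet n l)
      (kktPair F φ (p, WithLp.toLp 2 (x, y)))
      (fderiv ℝ (kktPair F φ) (p, WithLp.toLp 2 (x, y)) (w, WithLp.toLp 2 (u, v))))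
    (horth : ∀ ζ, inner ℝ (WithLp.toLp 2 (z, WithLp.toLp 2 (lam, d)))
      (fderiv ℝ (kktPair F φ) (p, WithLp.toLp 2 (x, y)) (0, ζ)) = 0) :
    AdjointKKT F φ p x y w u v z lam d := by
  -- Orthogonality to the range of the partial derivative, tested with `b = 0` and then `a = 0`,
  -- separates into the two adjoint equations.
  have h : ∀ (a : Vec n) (b : Vec l),
      inner ℝ z (fderiv ℝ (fun x' => lagrangian F φ p x' y) x a + partialGradAdjoint φ p x b)
        + (inner ℝ lam (fderiv ℝ (φ p) x a) + inner ℝ d b) = 0 := by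
    intro a b
    have h1 := horth (WithLp.toLp 2 (a, b))
    have h2 : fderiv ℝ (Function.uncurry φ) (p, x) (0, a) = fderiv ℝ (φ p) x a := by
      rw [(hasFDerivAt_partial hφ p x).fderiv]
      rfl
    rw [fderiv_kktPair_apply hF hφ, WithLp.prod_inner_apply] at h1
    simpa [WithLp.prod_inner_apply, h2] using h1
  refine ⟨ext_inner_right ℝ fun a => ?_, ext_inner_right ℝ fun b => ?_, ?_⟩
  · have h1 := h a 0
    rw [inner_add_left, inner_zero_left, ContinuousLinearMap.adjoint_inner_left,
      partialGradAdjoint, ContinuousLinearMap.adjoint_inner_left]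
    simpa using h1
  · have h1 := h 0 b
    rw [partialGradAdjoint, map_zero, zero_add, map_zero, inner_zero_right, zero_add,
      ContinuousLinearMap.adjoint_inner_right] at h1
    rwa [inner_add_left, inner_zero_left]
  · have h1 := snd_mem_directionalNormalCone hnormal
    rw [fderiv_kktPair_apply hF hφ] at h1
    exact h1

end KKTDerivative

/-! ### Application to the KKT system. -/

theorem theorem5p2 {m n l : ℕ} (P : Set (Vec m))
    (F : Vec m → Vec n → Vec n) (φ : Vec m → Vec n → Vec l)
    (hF : ContDiff ℝ 1 (Function.uncurry F)) (hφ : ContDiff ℝ 2 (Function.uncurry φ))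
    (pbar : P) (xbar : Vec n) (ybar : Vec l)
    (hbar : WithLp.toLp 2 (xbar, ybar) ∈ solutionMap (kktMap P F φ) (kktSet n l) pbar)
    (hlin : ∀ w ∈ contingentCone P (pbar : Vec m), ∃ (u : Vec n) (v : Vec l),
      LinearizedKKT F φ pbar xbar ybar w u v)
    (hadj : ∀ w ∈ contingentCone P (pbar : Vec m), ∀ (u : Vec n) (v : Vec l),
      (w, u, v) ≠ (0, 0, 0) → LinearizedKKT F φ pbar xbar ybar w u v →
      ∀ (z : Vec n) (lam d : Vec l), AdjointKKT F φ pbar xbar ybar w u v z lam d →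
        (z, lam) = (0, 0)) :
    RobinsonStable (kktMap P F φ) (kktSet n l) pbar (WithLp.toLp 2 (xbar, ybar)) ∧
    LipschitzLike (solutionMap (kktMap P F φ) (kktSet n l)) pbar
      (WithLp.toLp 2 (xbar, ybar)) := by

  have hmem : kktPair F φ ((pbar : Vec m), WithLp.toLp 2 (xbar, ybar)) ∈ kktSet n l := hbar
  have hf := contDiff_kktPair hF hφ
  have hmul : DirectionalMultiplierCondition P (kktPair F φ) (kktSet n l) (pbar : Vec m)
      (WithLp.toLp 2 (xbar, ybar)) := by
    intro w hw ζ hne htan mu hnormal horth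
    obtain ⟨u, v⟩ := ζ
    obtain ⟨z, r⟩ := mu
    obtain ⟨lam, d⟩ := r
    have hkkt := (fderiv_kktPair_mem_iff hF hφ hmem).1 htan
    have hadjoint := adjointKKT_of_mem_directionalNormalCone hF hφ hnormal horth
    have hzero := hadj w hw u v (fun h0 => hne ?_) hkkt z lam d hadjoint
    · obtain ⟨rfl, rfl⟩ := Prod.mk.inj hzero
      -- The hypothesis kills only `z` and `lam`; the equation `∇ₓφ z + d = 0` then removes `d`.
      have hd : d = 0 := by simpa using hadjoint.2.1
      rw [hd]
      rfl
    · simp only [Prod.mk.injEq] at h0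
      obtain ⟨rfl, rfl, rfl⟩ := h0
      rfl
  have hmap : kktMap P F φ = fun (p : P) ξ => kktPair F φ (p, ξ) := rfl
  rw [hmap]
  have hrob := robinsonStable_of_directionalMultiplierCondition hmul hf (isClosed_kktSet n l) hmem
    (hasExactTangents_kktSet hmem) fun w hw => by
      obtain ⟨u, v, huv⟩ := hlin w hw
      exact ⟨WithLp.toLp 2 (u, v), (fderiv_kktPair_mem_iff hF hφ hmem).2 huv⟩
  exact ⟨hrob, hrob.lipschitzLike hf (isClosed_kktSet n l)⟩
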